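/- There is exactly one infinitely differentiable function $\varphi\colon\mathbb R\to\mathbb R$ such that (a) $\operatorname{supp}(\varphi)=[-1,1]$; (b) $\varphi(t)>0$ for every $t\in(-1,1)$; (c) $\varphi(0)=1$; (d) there is a constant $k>0$ with $\varphi'(t)=k\bigl(\varphi(2t+1)-\varphi(2t-1)\bigr)$ for every $t\in\mathbb R$. Let $\sigma=\bigotimes_{k=1}^\infty\lambda_k$ be the product measure on $[0,1]^{\mathbb N}$, where each $\lambda_k$ is Lebesgue measure on $[0,1]$. Then for $-1\le x\le 0$ this function $\varphi$ satisfies \[\varphi(x)=\sigma\Bigl\{(x_k)_{k\ge1}\colon 0\le\sum_{k=1}^\infty\frac{x_k}{2^k}\le x+1\Bigr\}.\] In other words, if $X_1,X_2,\dots$ are independent random variables, uniformly distributed in $[0,1]$, on any probability space, then for $-1\le x\le 0$ the value $\varphi(x)$ is the probability that $\sum_{k=1}^\infty X_k2^{-k}\le x+1$. -/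

import Mathlib

open MeasureTheory ProbabilityTheory
open scoped ContDiff unitInterval

/-- The conditions that single out the function `φ`: it is infinitely differentiable, its
(closed) support is `[-1, 1]`, it is positive on `(-1, 1)`, `φ 0 = 1`, and for some constant
`k > 0` one has `φ'(t) = k (φ(2t+1) - φ(2t-1))` for all real `t`. -/
structure IsSelfSimilarBump (φ : ℝ → ℝ) : Prop where
  smooth : ContDiff ℝ ∞ φ
  support_eq : tsupport φ = Set.Icc (-1) 1
  pos : ∀ t ∈ Set.Ioo (-1 : ℝ) 1, 0 < φ t
  map_zero : φ 0 = 1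
  deriv_eq : ∃ k : ℝ, 0 < k ∧ ∀ t : ℝ, deriv φ t = k * (φ (2 * t + 1) - φ (2 * t - 1))

/-- The product measure `σ = ⨂ λ_k` on `[0,1]^ℕ`, each factor being Lebesgue measure
on `[0,1]`. The coordinate written `x_k`, `k ≥ 1`, has index `k - 1 : ℕ`. -/
noncomputable def cubeMeasure : Measure (ℕ → I) :=
  Measure.infinitePi fun _ : ℕ => (volume : Measure I)

/-!
Write `S = ∑ k, X k / 2 ^ (k + 1)` with `X k` independent and uniform on `[0, 1]`, and let `F` be
its distribution function. Splitting off the first term, `S = (X 0 + S') / 2` with `S'` a copy of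
`S` independent of `X 0`; conditioning on `X 0` gives the averaging equation
`F y = ∫ s in (2 * y - 1)..(2 * y), F s` (`dyadicCDF_eq_integral`). Moreover `F = 0` on `(-∞, 0]`
and `F = 1` on `[1, ∞)`. The proof rests on the fact that these properties determine `F` among
continuous functions (`IsDyadicCDF.unique`): if `F` and `G` both satisfy them, a maximum of
`|F - G|` is at most the mean of `|F - G|` over a window of length one, so `|F - G|` equals its
maximum throughout that window, and the window contains a point outside `(0, 1)`, where
`F - G = 0`.

*Existence.* Differentiating the averaging equation gives `F' y = 2 * (F (2 * y) - F (2 * y - 1))`,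
so `F` is smooth, and `φ x = F (x + 1) - F x` satisfies the functional equation with `k = 2`. It is
positive on `(-1, 1)` because `0 < F` on `(0, ∞)` and `F < 1` on `(-∞, 1)`: a zero of `F` at `y`
forces one at `2 * y`, hence eventually one beyond `1`, and `y ↦ 1 - F (1 - y)` has the same
properties as `F` (`IsDyadicCDF.isSelfSimilarBump`).

*Uniqueness.* Let `φ` be any bump as in the theorem. Integrating the functional equation shows that
`∫ φ = 1` and `k = 2` (`IsSelfSimilarBump.integral_eq_one_and_eq_integral`), and then
`H y = ∫ s in (-1)..(2 * y - 1), φ s` has all the properties above, while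
`φ x = H (x + 1) - H x`. As `H = F`, this gives `φ x = F (x + 1) - F x`
(`IsSelfSimilarBump.eq_sub`), which for `-1 ≤ x ≤ 0` is `F (x + 1)`, the asserted probability.
-/

/-! ### The averaging equation `F y = ∫ s in (2y - 1)..2y, F s` -/

/-- The analytic properties that characterise the distribution function `F` of
`∑ k, X k / 2 ^ (k + 1)` with `X k` independent and uniform on `[0, 1]`: it is continuous, it is `0`
on `(-∞, 0]` and `1` on `[1, ∞)`, and its value at `y` is its mean over `[2 * y - 1, 2 * y]`. -/
structure IsDyadicCDF (F : ℝ → ℝ) : Prop where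
  continuous : Continuous F
  eq_zero : ∀ y ≤ 0, F y = 0
  eq_one : ∀ y, 1 ≤ y → F y = 1
  eq_integral : ∀ y, F y = ∫ s in (2 * y - 1)..(2 * y), F s

theorem Continuous.eq_zero_of_intervalIntegral_nonpos {g : ℝ → ℝ} (hg : Continuous g)
    (h0 : ∀ y, 0 ≤ g y) {a b : ℝ} (hab : a < b) (hint : ∫ s in a..b, g s ≤ 0) :
    ∀ c ∈ Set.Icc a b, g c = 0 := by
  intro c hc
  by_contra hne
  exact (intervalIntegral.integral_pos hab hg.continuousOn (fun x _ => h0 x)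
    ⟨c, hc, lt_of_le_of_ne (h0 c) (Ne.symm hne)⟩).not_ge hint

theorem hasDerivAt_intervalIntegral {F : ℝ → ℝ} (hF : Continuous F) (a y : ℝ) :
    HasDerivAt (fun y => ∫ s in a..y, F s) (F y) y :=
  intervalIntegral.integral_hasDerivAt_right (hF.intervalIntegrable _ _)
    (hF.stronglyMeasurableAtFilter _ _) hF.continuousAt

theorem hasDerivAt_integral_unit_window {F : ℝ → ℝ} (hF : Continuous F) (y : ℝ) :
    HasDerivAt (fun y => ∫ s in (2 * y - 1)..(2 * y), F s) (2 * (F (2 * y) - F (2 * y - 1))) y := by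
  have h2 : HasDerivAt (fun y : ℝ => 2 * y) 2 y := by
    simpa using (hasDerivAt_id y).const_mul (2 : ℝ)
  have h := ((hasDerivAt_intervalIntegral hF 0 (2 * y)).comp y h2).sub
    ((hasDerivAt_intervalIntegral hF 0 (2 * y - 1)).comp y (h2.sub_const 1))
  have hfun : (fun y => ∫ s in (2 * y - 1)..(2 * y), F s) =
      fun y => (∫ s in (0 : ℝ)..(2 * y), F s) - ∫ s in (0 : ℝ)..(2 * y - 1), F s :=
    funext fun z => (intervalIntegral.integral_interval_sub_left (hF.intervalIntegrable _ _)
      (hF.intervalIntegrable _ _)).symm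
  rw [hfun]
  exact h.congr_deriv (by ring)

/-- The differential form of the averaging equation implies its integral form. -/
theorem IsDyadicCDF.of_hasDerivAt {H : ℝ → ℝ} (h0 : ∀ y ≤ 0, H y = 0) (h1 : ∀ y, 1 ≤ y → H y = 1)
    (hd : ∀ y, HasDerivAt H (2 * (H (2 * y) - H (2 * y - 1))) y) : IsDyadicCDF H := by
  have hc : Continuous H := continuous_iff_continuousAt.2 fun y => (hd y).continuousAt
  refine ⟨hc, h0, h1, fun y => ?_⟩
  have hdiff : ∀ z, HasDerivAt (fun y => H y - ∫ s in (2 * y - 1)..(2 * y), H s) 0 z := by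
    intro z
    exact ((hd z).sub (hasDerivAt_integral_unit_window hc z)).congr_deriv (sub_self _)
  have hconst := is_const_of_deriv_eq_zero (fun z => (hdiff z).differentiableAt)
    (fun z => (hdiff z).deriv) y 0
  have hint : ∫ s in (2 * (0 : ℝ) - 1)..(2 * 0), H s = 0 := by
    rw [intervalIntegral.integral_congr (g := fun _ => (0 : ℝ))]
    · simp
    · intro s hs
      rw [Set.uIcc_of_le (by norm_num)] at hs
      exact h0 s (by linarith [hs.2])
  simp only [h0 0 le_rfl, hint] at hconst
  linarith

namespace IsDyadicCDF

variable {F G : ℝ → ℝ}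

/-- Maximum principle: where `|F - G|` is largest, it must be constant on a window of length one
that reaches outside `(0, 1)`, where `F` and `G` agree. -/
theorem unique (hF : IsDyadicCDF F) (hG : IsDyadicCDF G) : F = G := by
  set D : ℝ → ℝ := fun y => |F y - G y| with hD
  have hDc : Continuous D := (hF.continuous.sub hG.continuous).abs
  have hD0 : ∀ y ≤ 0, D y = 0 := fun y hy => by simp [hD, hF.eq_zero y hy, hG.eq_zero y hy]
  have hD1 : ∀ y, 1 ≤ y → D y = 0 := fun y hy => by simp [hD, hF.eq_one y hy, hG.eq_one y hy]
  obtain ⟨m, -, hmax⟩ := (isCompact_Icc (a := (0 : ℝ)) (b := 1)).exists_isMaxOn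
    ⟨0, by simp⟩ hDc.continuousOn
  have hle : ∀ y, D y ≤ D m := by
    intro y
    rcases le_total y 0 with h | h
    · rw [hD0 y h]; exact abs_nonneg _
    rcases le_total 1 y with h' | h'
    · rw [hD1 y h']; exact abs_nonneg _
    exact hmax ⟨h, h'⟩
  have hmean : D m ≤ ∫ s in (2 * m - 1)..(2 * m), D s := by
    simp only [hD]
    rw [hF.eq_integral m, hG.eq_integral m, ← intervalIntegral.integral_sub
      (hF.continuous.intervalIntegrable _ _) (hG.continuous.intervalIntegrable _ _)]
    exact intervalIntegral.abs_integral_le_integral_abs (by linarith)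
  have hzero := Continuous.eq_zero_of_intervalIntegral_nonpos (g := fun s => D m - D s)
    (continuous_const.sub hDc) (fun y => sub_nonneg.2 (hle y)) (a := 2 * m - 1) (b := 2 * m)
    (by linarith) (by
      rw [intervalIntegral.integral_sub (by simp) (hDc.intervalIntegrable _ _)]
      simp only [intervalIntegral.integral_const, smul_eq_mul]
      linarith)
  have hm : D m = 0 := by
    rcases le_total m (1 / 2) with h | h
    · have := hzero (2 * m - 1) ⟨le_rfl, by linarith⟩
      linarith [hD0 (2 * m - 1) (by linarith)]
    · have := hzero (2 * m) ⟨by linarith, le_rfl⟩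
      linarith [hD1 (2 * m) (by linarith)]
  funext y
  have : D y = 0 := le_antisymm (hm ▸ hle y) (abs_nonneg _)
  exact sub_eq_zero.1 (abs_eq_zero.1 this)

/-- A zero of `F` at some `y > 0` would propagate to `2 ^ n * y` for all `n`. -/
theorem pos (hF : IsDyadicCDF F) (h0 : ∀ y, 0 ≤ F y) {y : ℝ} (hy : 0 < y) : 0 < F y := by
  by_contra hneg
  have hstep : ∀ z, F z = 0 → F (2 * z) = 0 := fun z hz =>
    hF.continuous.eq_zero_of_intervalIntegral_nonpos h0 (by linarith)
      ((hF.eq_integral z).symm.trans hz).le (2 * z) ⟨by linarith, le_rfl⟩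
  have hiter : ∀ n : ℕ, F (2 ^ n * y) = 0 := by
    intro n
    induction n with
    | zero => simpa using le_antisymm (not_lt.1 hneg) (h0 y)
    | succ n ih => rw [pow_succ', mul_assoc]; exact hstep _ ih
  obtain ⟨n, hn⟩ := pow_unbounded_of_one_lt (1 / y) (one_lt_two (α := ℝ))
  have h1 := hF.eq_one (2 ^ n * y) ((div_lt_iff₀ hy).1 hn).le
  linarith [hiter n]

theorem reflect (hF : IsDyadicCDF F) : IsDyadicCDF fun y => 1 - F (1 - y) where
  continuous := by have := hF.continuous; fun_prop
  eq_zero y hy := by rw [hF.eq_one _ (by linarith), sub_self]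
  eq_one y hy := by rw [hF.eq_zero _ (by linarith), sub_zero]
  eq_integral y := by
    have hc := hF.continuous
    rw [intervalIntegral.integral_sub (by simp)
      (Continuous.intervalIntegrable (by fun_prop) _ _),
      intervalIntegral.integral_comp_sub_left (fun s => F s), hF.eq_integral (1 - y)]
    simp only [intervalIntegral.integral_const, smul_eq_mul]
    congr 2 <;> ring

theorem lt_one (hF : IsDyadicCDF F) (h1 : ∀ y, F y ≤ 1) {y : ℝ} (hy : y < 1) : F y < 1 := by
  have := hF.reflect.pos (fun z => by linarith [h1 (1 - z)]) (y := 1 - y) (by linarith)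
  rw [sub_sub_cancel] at this
  linarith

theorem hasDerivAt (hF : IsDyadicCDF F) (y : ℝ) :
    HasDerivAt F (2 * (F (2 * y) - F (2 * y - 1))) y := by
  have h := hasDerivAt_integral_unit_window hF.continuous y
  rwa [← funext hF.eq_integral] at h

theorem contDiff (hF : IsDyadicCDF F) : ContDiff ℝ ∞ F := by
  rw [contDiff_infty]
  intro n
  induction n with
  | zero => exact contDiff_zero.2 hF.continuous
  | succ n ih =>
    rw [Nat.cast_succ, contDiff_succ_iff_deriv]
    refine ⟨fun y => (hF.hasDerivAt y).differentiableAt, by simp, ?_⟩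
    rw [funext fun y => (hF.hasDerivAt y).deriv]
    fun_prop

/-! ### Passing between bumps and solutions of the averaging equation -/

theorem isSelfSimilarBump (hF : IsDyadicCDF F) (h0 : ∀ y, 0 ≤ F y) (h1 : ∀ y, F y ≤ 1) :
    IsSelfSimilarBump fun x => F (x + 1) - F x := by
  have hpos : ∀ t ∈ Set.Ioo (-1 : ℝ) 1, 0 < F (t + 1) - F t := by
    intro t ht
    rcases le_total t 0 with h | h
    · rw [hF.eq_zero t h, sub_zero]
      exact hF.pos h0 (by linarith [ht.1])
    · rw [hF.eq_one (t + 1) (by linarith)]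
      linarith [hF.lt_one h1 ht.2]
  refine ⟨?_, ?_, hpos, ?_, 2, two_pos, fun t => ?_⟩
  · have := hF.contDiff
    fun_prop
  · have hsupp : Function.support (fun x => F (x + 1) - F x) = Set.Ioo (-1) 1 := by
      ext t
      refine ⟨fun ht => ?_, fun ht => (hpos t ht).ne'⟩
      by_contra hout
      refine ht ?_
      rcases le_or_gt t (-1) with h | h
      · simp [hF.eq_zero (t + 1) (by linarith), hF.eq_zero t (by linarith)]
      · have h' : 1 ≤ t := not_lt.1 fun h' => hout ⟨h, h'⟩
        simp [hF.eq_one (t + 1) (by linarith), hF.eq_one t h']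
    rw [tsupport, hsupp, closure_Ioo (by norm_num)]
  · simp [hF.eq_zero 0 le_rfl, hF.eq_one 1 le_rfl]
  · have h := ((hF.hasDerivAt (t + 1)).comp_add_const t 1).sub (hF.hasDerivAt t)
    rw [HasDerivAt.deriv (f := fun x => F (x + 1) - F x) h]
    ring_nf

end IsDyadicCDF

namespace IsSelfSimilarBump

variable {φ : ℝ → ℝ}

theorem eq_zero_of_one_le (hφ : IsSelfSimilarBump φ) {t : ℝ} (ht : 1 ≤ t) : φ t = 0 := by
  have hopen : Set.EqOn φ 0 (Set.Ioi 1) := fun s hs =>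
    image_eq_zero_of_notMem_tsupport fun h => by
      rw [hφ.support_eq] at h
      exact absurd h.2 (not_le.2 hs)
  have := hopen.closure hφ.smooth.continuous continuous_const
  rw [closure_Ioi] at this
  exact this ht

theorem eq_zero_of_le_neg_one (hφ : IsSelfSimilarBump φ) {t : ℝ} (ht : t ≤ -1) : φ t = 0 := by
  have hopen : Set.EqOn φ 0 (Set.Iio (-1)) := fun s hs =>
    image_eq_zero_of_notMem_tsupport fun h => by
      rw [hφ.support_eq] at h
      exact absurd h.1 (not_le.2 hs)
  have := hopen.closure hφ.smooth.continuous continuous_const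
  rw [closure_Iio] at this
  exact this ht

theorem integral_eq_zero (hφ : IsSelfSimilarBump φ) {y : ℝ} (hy : y ≤ -1) :
    ∫ s in (-1)..y, φ s = 0 := by
  rw [intervalIntegral.integral_congr (g := fun _ => (0 : ℝ))]
  · simp
  · intro s hs
    rw [Set.uIcc_of_ge hy] at hs
    exact hφ.eq_zero_of_le_neg_one hs.2

theorem integral_eq_total (hφ : IsSelfSimilarBump φ) {y : ℝ} (hy : 1 ≤ y) :
    ∫ s in (-1)..y, φ s = ∫ s in (-1)..1, φ s := by
  have hc := hφ.smooth.continuous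
  rw [← intervalIntegral.integral_add_adjacent_intervals (b := 1) (hc.intervalIntegrable _ _)
    (hc.intervalIntegrable _ _), intervalIntegral.integral_congr (a := 1) (g := fun _ => (0 : ℝ))]
  · simp
  · intro s hs
    rw [Set.uIcc_of_le hy] at hs
    exact hφ.eq_zero_of_one_le hs.1

/-- The integrated functional equation. The integral of `φ` over `[-1, 1]` and the constant `k` of
the functional equation are linked by `φ 0 = 1`; the normalisation `∫ φ = 1` then follows from
`φ x + φ (x - 1) = 1` on `[0, 1]`, so that `k = 2`. -/
theorem integral_eq_one_and_eq_integral (hφ : IsSelfSimilarBump φ) :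
    ∫ s in (-1)..1, φ s = 1 ∧
    ∀ x, φ x = (∫ s in (-1)..(2 * x + 1), φ s) - ∫ s in (-1)..(2 * x - 1), φ s := by
  obtain ⟨k, hk, hderiv⟩ := hφ.deriv_eq
  have hc := hφ.smooth.continuous
  set G : ℝ → ℝ := fun y => ∫ s in (-1)..y, φ s with hG
  have hφd : ∀ x, HasDerivAt φ (k * (φ (2 * x + 1) - φ (2 * x - 1))) x := fun x => by
    rw [← hderiv x]
    exact (hφ.smooth.differentiable (by simp) x).hasDerivAt
  have hint : ∀ x, φ x = k / 2 * (G (2 * x + 1) - G (2 * x - 1)) := by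
    intro x
    have hdiff : ∀ z, HasDerivAt (fun x => φ x - k / 2 * (G (2 * x + 1) - G (2 * x - 1))) 0 z := by
      intro z
      have h2 : HasDerivAt (fun y : ℝ => 2 * y) 2 z := by
        simpa using (hasDerivAt_id z).const_mul (2 : ℝ)
      have h := (hφd z).sub ((((hasDerivAt_intervalIntegral hc (-1) (2 * z + 1)).comp z
        (h2.add_const 1)).sub ((hasDerivAt_intervalIntegral hc (-1) (2 * z - 1)).comp z
        (h2.sub_const 1))).const_mul (k / 2))
      exact h.congr_deriv (by ring)
    have hconst := is_const_of_deriv_eq_zero (fun z => (hdiff z).differentiableAt)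
      (fun z => (hdiff z).deriv) x (-1)
    simp only [hφ.eq_zero_of_le_neg_one le_rfl] at hconst
    have e1 : G (2 * -1 + 1) = 0 := hφ.integral_eq_zero (by norm_num)
    have e2 : G (2 * -1 - 1) = 0 := hφ.integral_eq_zero (by norm_num)
    rw [e1, e2] at hconst
    linarith
  have hkG : k / 2 * G 1 = 1 := by
    have h := hint 0
    have e : G (2 * 0 - 1) = 0 := hφ.integral_eq_zero (by norm_num)
    rw [e, hφ.map_zero] at h
    simpa using h.symm
  have hsum : ∀ x ∈ Set.Icc (0 : ℝ) 1, φ x + φ (x - 1) = 1 := by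
    intro x hx
    have e1 : G (2 * x + 1) = G 1 := hφ.integral_eq_total (by linarith [hx.1])
    have e2 : G (2 * (x - 1) - 1) = 0 := hφ.integral_eq_zero (by linarith [hx.2])
    rw [hint x, hint (x - 1), e1, e2, show 2 * (x - 1) + 1 = 2 * x - 1 by ring]
    linarith
  have hG1 : G 1 = 1 := by
    have h : ∫ x in (0 : ℝ)..1, (φ x + φ (x - 1)) = 1 := by
      rw [intervalIntegral.integral_congr (g := fun _ => (1 : ℝ))]
      · simp
      · intro s hs
        rw [Set.uIcc_of_le zero_le_one] at hs
        exact hsum s hs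
    rw [intervalIntegral.integral_add (hc.intervalIntegrable _ _)
      (Continuous.intervalIntegrable (by fun_prop) _ _),
      intervalIntegral.integral_comp_sub_right (fun s => φ s), zero_sub, sub_self, add_comm,
      intervalIntegral.integral_add_adjacent_intervals (hc.intervalIntegrable _ _)
      (hc.intervalIntegrable _ _)] at h
    exact h
  refine ⟨hG1, fun x => ?_⟩
  rw [hG1, mul_one] at hkG
  have h := hint x
  rwa [hkG, one_mul] at h

theorem isDyadicCDF (hφ : IsSelfSimilarBump φ) :
    IsDyadicCDF fun y => ∫ s in (-1)..(2 * y - 1), φ s := by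
  obtain ⟨htotal, heq⟩ := hφ.integral_eq_one_and_eq_integral
  refine .of_hasDerivAt (fun y hy => hφ.integral_eq_zero (by linarith))
    (fun y hy => (hφ.integral_eq_total (by linarith)).trans htotal) fun y => ?_
  have h2 : HasDerivAt (fun y : ℝ => 2 * y) 2 y := by
    simpa using (hasDerivAt_id y).const_mul (2 : ℝ)
  have h := (hasDerivAt_intervalIntegral hφ.smooth.continuous (-1) (2 * y - 1)).comp y
    (h2.sub_const 1)
  refine h.congr_deriv ?_
  rw [heq (2 * y - 1)]
  ring_nf

/-- Every bump arises from the one solution of the averaging equation. -/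
theorem eq_sub (hφ : IsSelfSimilarBump φ) {F : ℝ → ℝ} (hF : IsDyadicCDF F) (x : ℝ) :
    φ x = F (x + 1) - F x := by
  rw [hF.unique hφ.isDyadicCDF, hφ.integral_eq_one_and_eq_integral.2 x]
  ring_nf

end IsSelfSimilarBump

/-! ### The random series `∑ k, x k / 2 ^ (k + 1)` -/

/-- The random variable `∑ k, ξ k / 2 ^ (k + 1)` on the cube `[0, 1]^ℕ`. -/
noncomputable def dyadicSeries (ξ : ℕ → I) : ℝ := ∑' k : ℕ, (ξ k : ℝ) / 2 ^ (k + 1)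

theorem hasSum_one_div_two_pow_succ : HasSum (fun k : ℕ => (1 : ℝ) / 2 ^ (k + 1)) 1 := by
  have h := hasSum_geometric_two' 1
  convert h using 2 with k
  rw [pow_succ', div_div]

theorem div_two_pow_succ_le (ξ : ℕ → I) (k : ℕ) : (ξ k : ℝ) / 2 ^ (k + 1) ≤ 1 / 2 ^ (k + 1) := by
  have := (ξ k).2.2
  gcongr

theorem summable_dyadicSeries (ξ : ℕ → I) : Summable fun k : ℕ => (ξ k : ℝ) / 2 ^ (k + 1) :=
  .of_nonneg_of_le (fun k => div_nonneg (ξ k).2.1 (by positivity)) (div_two_pow_succ_le ξ)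
    hasSum_one_div_two_pow_succ.summable

theorem dyadicSeries_nonneg (ξ : ℕ → I) : 0 ≤ dyadicSeries ξ :=
  tsum_nonneg fun k => div_nonneg (ξ k).2.1 (by positivity)

theorem dyadicSeries_le_one (ξ : ℕ → I) : dyadicSeries ξ ≤ 1 :=
  hasSum_one_div_two_pow_succ.tsum_eq ▸ (summable_dyadicSeries ξ).tsum_le_tsum
    (div_two_pow_succ_le ξ) hasSum_one_div_two_pow_succ.summable

theorem measurable_dyadicSeries : Measurable dyadicSeries := by
  refine Continuous.measurable (continuous_tsum (u := fun k : ℕ => 1 / 2 ^ (k + 1))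
    (fun k => by fun_prop) hasSum_one_div_two_pow_succ.summable fun k ξ => ?_)
  rw [Real.norm_of_nonneg (div_nonneg (ξ k).2.1 (by positivity))]
  exact div_two_pow_succ_le ξ k

/-- Prepend a term to a sequence. -/
def prependTerm {α : Type*} (p : α × (ℕ → α)) : ℕ → α
  | 0 => p.1
  | k + 1 => p.2 k

theorem measurable_prependTerm {α : Type*} [MeasurableSpace α] :
    Measurable (prependTerm (α := α)) := by
  refine measurable_pi_lambda _ fun k => ?_
  cases k with
  | zero => exact measurable_fst
  | succ k => exact (measurable_pi_apply k).comp measurable_snd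

theorem dyadicSeries_prependTerm (u : I) (ξ : ℕ → I) :
    dyadicSeries (prependTerm (u, ξ)) = (u + dyadicSeries ξ) / 2 := by
  rw [dyadicSeries, (summable_dyadicSeries _).tsum_eq_zero_add, add_div, dyadicSeries,
    ← tsum_div_const]
  congr 1
  · simp [prependTerm]
  · refine tsum_congr fun k => ?_
    rw [div_div, ← pow_succ]
    rfl

/-- Prepending an independent term with law `μ` to an i.i.d. sequence with law `μ` gives such a
sequence again. -/
theorem map_prependTerm_prod_infinitePi {α : Type*} [MeasurableSpace α] (μ : Measure α)
    [IsProbabilityMeasure μ] :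
    (μ.prod (Measure.infinitePi fun _ : ℕ => μ)).map prependTerm =
      Measure.infinitePi fun _ : ℕ => μ := by
  refine Measure.eq_infinitePi _ fun s t ht => ?_
  rw [Measure.map_apply measurable_prependTerm (.pi s.countable_toSet fun i _ => ht i)]
  -- Outside `s` every factor is replaced by the whole space, so that `s` may be enlarged to an
  -- initial segment, from which the term of index `0` splits off.
  classical
  set t' : ℕ → Set α := fun i => if i ∈ s then t i else Set.univ with ht'
  have ht'm : ∀ i, MeasurableSet (t' i) := fun i => by
    by_cases h : i ∈ s <;> simp [ht', h, ht i]
  obtain ⟨n, hn⟩ := s.exists_nat_subset_range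
  have hn' : s ⊆ Finset.range (n + 1) := hn.trans (Finset.range_mono n.le_succ)
  have hpre : prependTerm ⁻¹' (Set.pi s t) =
      t' 0 ×ˢ Set.pi (Finset.range n) fun i => t' (i + 1) := by
    ext p
    simp only [Set.mem_preimage, Set.mem_pi, Set.mem_prod, SetLike.mem_coe, Finset.mem_range]
    constructor
    · intro h
      have h' : ∀ i, prependTerm p i ∈ t' i := fun i => by
        by_cases hi : i ∈ s
        · simpa [ht', hi] using h i hi
        · simp [ht', hi]
      exact ⟨h' 0, fun i _ => h' (i + 1)⟩
    · rintro ⟨h0, h⟩ i hi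
      have h' : prependTerm p i ∈ t' i := by
        cases i with
        | zero => exact h0
        | succ i => exact h i (by simpa using hn' hi)
      simpa [ht', hi] using h'
  rw [hpre, Measure.prod_prod, Measure.infinitePi_pi _ (fun i _ => ht'm (i + 1)), mul_comm,
    ← Finset.prod_range_succ' (fun i => μ (t' i)), ← Finset.prod_subset hn']
  · exact Finset.prod_congr rfl fun i hi => by simp [ht', hi]
  · intro i _ hi
    simp [ht', hi]

instance : IsProbabilityMeasure cubeMeasure := by
  unfold cubeMeasure
  infer_instance

/-- The distribution function of `dyadicSeries` under the product measure on the cube. -/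
noncomputable def dyadicCDF (y : ℝ) : ℝ := cubeMeasure.real {ξ | dyadicSeries ξ ≤ y}

theorem dyadicCDF_nonneg (y : ℝ) : 0 ≤ dyadicCDF y := measureReal_nonneg

theorem dyadicCDF_le_one (y : ℝ) : dyadicCDF y ≤ 1 := measureReal_le_one

theorem monotone_dyadicCDF : Monotone dyadicCDF := fun _ _ h =>
  measureReal_mono fun _ hξ => le_trans hξ h

/-- If `X` is uniform on `[0, 1]` and `S` is an independent copy of the series, then `(X + S) / 2`
is again distributed like the series; conditioning on `X` gives the averaging equation. -/
theorem dyadicCDF_eq_integral (y : ℝ) :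
    dyadicCDF y = ∫ s in (2 * y - 1)..(2 * y), dyadicCDF s := by
  have hmeas : ∀ z : ℝ, MeasurableSet {ξ | dyadicSeries ξ ≤ z} := fun z =>
    measurableSet_le measurable_dyadicSeries measurable_const
  have hpre : MeasurableSet (prependTerm ⁻¹' {ξ | dyadicSeries ξ ≤ y}) :=
    measurable_prependTerm (hmeas y)
  have hslice : ∀ u : I, Prod.mk u ⁻¹' (prependTerm ⁻¹' {ξ | dyadicSeries ξ ≤ y}) =
      {ξ | dyadicSeries ξ ≤ 2 * y - u} := by
    intro u
    ext ξ
    simp only [Set.mem_preimage, Set.mem_ofPred_eq, dyadicSeries_prependTerm]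
    constructor <;> intro h <;> linarith
  have hprod : dyadicCDF y = ∫ u : I, dyadicCDF (2 * y - u) := by
    have hmap := map_prependTerm_prod_infinitePi (volume : Measure I)
    change Measure.map prependTerm (volume.prod cubeMeasure) = cubeMeasure at hmap
    unfold dyadicCDF
    conv_lhs => rw [← hmap]
    rw [measureReal_def, Measure.map_apply measurable_prependTerm (hmeas y),
      Measure.prod_apply hpre, ← integral_toReal (measurable_measure_prodMk_left hpre).aemeasurable
        (.of_forall fun u => measure_lt_top _ _)]
    simp only [hslice]
    rfl
  rw [hprod, integral_subtype measurableSet_Icc (fun u : ℝ => dyadicCDF (2 * y - u)),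
    integral_Icc_eq_integral_Ioc, ← intervalIntegral.integral_of_le zero_le_one,
    intervalIntegral.integral_comp_sub_left (fun s => dyadicCDF s), sub_zero]

theorem isDyadicCDF_dyadicCDF : IsDyadicCDF dyadicCDF := by
  have hint : ∀ a b, IntervalIntegrable dyadicCDF volume a b := fun a b =>
    monotone_dyadicCDF.intervalIntegrable
  have hcont : Continuous dyadicCDF := by
    have hprim := intervalIntegral.continuous_primitive hint 0
    have heq : dyadicCDF = fun y =>
        (∫ s in (0 : ℝ)..(2 * y), dyadicCDF s) - ∫ s in (0 : ℝ)..(2 * y - 1), dyadicCDF s :=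
      funext fun y => by
        rw [intervalIntegral.integral_interval_sub_left (hint _ _) (hint _ _)]
        exact dyadicCDF_eq_integral y
    rw [heq]
    exact (hprim.comp (by fun_prop : Continuous fun y : ℝ => 2 * y)).sub
      (hprim.comp (by fun_prop : Continuous fun y : ℝ => 2 * y - 1))
  have hneg : Set.EqOn dyadicCDF 0 (Set.Iio 0) := fun y hy => by
    have : {ξ | dyadicSeries ξ ≤ y} = ∅ :=
      Set.eq_empty_of_forall_notMem fun ξ h => absurd (dyadicSeries_nonneg ξ)
        (not_le.2 (lt_of_le_of_lt h hy))
    simp [dyadicCDF, this]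
  refine ⟨hcont, fun y hy => ?_, fun y hy => ?_, dyadicCDF_eq_integral⟩
  · have h := hneg.closure hcont continuous_const
    rw [closure_Iio] at h
    exact h hy
  · have : {ξ | dyadicSeries ξ ≤ y} = Set.univ :=
      Set.eq_univ_of_forall fun ξ => (dyadicSeries_le_one ξ).trans hy
    simp [dyadicCDF, this]

/-- The distribution function of `∑ k, X k / 2 ^ (k + 1)` does not depend on the choice of the
independent uniform variables `X k`. These take values in `[0, 1]` almost surely only, so they are
first projected to `[0, 1]`. -/
theorem measureReal_tsum_le_eq_dyadicCDF {Ω : Type*} [MeasurableSpace Ω] (P : Measure Ω)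
    [IsProbabilityMeasure P] (X : ℕ → Ω → ℝ) (hX : ∀ k, Measurable (X k)) (hind : iIndepFun X P)
    (hunif : ∀ k, pdf.IsUniform (X k) (Set.Icc 0 1) P volume) (y : ℝ) :
    P.real {w : Ω | ∑' k : ℕ, X k w / 2 ^ (k + 1) ≤ y} = dyadicCDF y := by
  have hlaw : ∀ k, P.map (X k) = volume.restrict (Set.Icc 0 1) := fun k => by
    rw [show P.map (X k) = _ from hunif k, ProbabilityTheory.cond]
    simp
  have hproj : Measurable (Set.projIcc (0 : ℝ) 1 zero_le_one) := continuous_projIcc.measurable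
  set Y : ℕ → Ω → I := fun k w => Set.projIcc 0 1 zero_le_one (X k w) with hY
  have hYm : ∀ k, Measurable (Y k) := fun k => hproj.comp (hX k)
  have hYlaw : ∀ k, P.map (Y k) = volume := fun k => by
    have h1 : P.map (Y k) = (P.map (X k)).map (Set.projIcc 0 1 zero_le_one) :=
      (Measure.map_map hproj (hX k)).symm
    rw [h1, hlaw k, ← unitInterval.measurePreserving_coe.map_eq,
      Measure.map_map hproj measurable_subtype_coe]
    have hid : Set.projIcc (0 : ℝ) 1 zero_le_one ∘ ((↑) : I → ℝ) = id :=
      funext fun u => Set.projIcc_val zero_le_one u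
    rw [hid, Measure.map_id]
  have hjoint : P.map (fun w k => Y k w) = cubeMeasure := by
    rw [(hind.comp (fun _ => Set.projIcc 0 1 zero_le_one)
      fun _ => hproj).map_fun_eq_infinitePi_map hYm]
    exact congrArg Measure.infinitePi (funext hYlaw)
  have hae : ∀ᵐ w ∂P, ∀ k, (Y k w : ℝ) = X k w := by
    refine ae_all_iff.2 fun k => ?_
    have hmem : ∀ᵐ x ∂(P.map (X k)), x ∈ Set.Icc (0 : ℝ) 1 := by
      rw [hlaw k]
      exact ae_restrict_mem measurableSet_Icc
    filter_upwards [ae_of_ae_map (hX k).aemeasurable hmem] with w hw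
    simp [hY, Set.projIcc_of_mem zero_le_one hw]
  rw [dyadicCDF, ← hjoint, measureReal_def, measureReal_def,
    Measure.map_apply (measurable_pi_lambda _ hYm)
      (measurableSet_le measurable_dyadicSeries measurable_const)]
  congr 1
  refine measure_congr (Filter.eventuallyEq_set.2 ?_)
  filter_upwards [hae] with w hw
  have hS : dyadicSeries (fun k => Y k w) = ∑' k : ℕ, X k w / 2 ^ (k + 1) :=
    tsum_congr fun k => by rw [hw k]
  change _ ↔ dyadicSeries (fun k => Y k w) ≤ y
  rw [hS]

/-! ### Existence, uniqueness and the probabilistic formula -/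

theorem theorem3 :
    (∃! φ : ℝ → ℝ, IsSelfSimilarBump φ) ∧
    ∀ φ : ℝ → ℝ, IsSelfSimilarBump φ → ∀ x ∈ Set.Icc (-1 : ℝ) 0,
      φ x = cubeMeasure.real
        {ξ : ℕ → I | 0 ≤ ∑' k : ℕ, (ξ k : ℝ) / 2 ^ (k + 1) ∧
          ∑' k : ℕ, (ξ k : ℝ) / 2 ^ (k + 1) ≤ x + 1} ∧
      ∀ (Ω : Type*) [MeasurableSpace Ω] (P : Measure Ω) [IsProbabilityMeasure P]
        (X : ℕ → Ω → ℝ), (∀ k, Measurable (X k)) → iIndepFun X P →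
        (∀ k, pdf.IsUniform (X k) (Set.Icc 0 1) P volume) →
        φ x = P.real {w : Ω | ∑' k : ℕ, X k w / 2 ^ (k + 1) ≤ x + 1} := by
  have hF := isDyadicCDF_dyadicCDF
  refine ⟨⟨_, hF.isSelfSimilarBump dyadicCDF_nonneg dyadicCDF_le_one,
    fun φ hφ => funext (hφ.eq_sub hF)⟩, fun φ hφ x hx => ?_⟩
  have hφx : φ x = dyadicCDF (x + 1) := by
    rw [hφ.eq_sub hF, hF.eq_zero x hx.2, sub_zero]
  refine ⟨?_, fun Ω _ P _ X hX hind hunif => ?_⟩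
  · rw [hφx, dyadicCDF]
    congr 1
    ext ξ
    exact (and_iff_right (dyadicSeries_nonneg ξ)).symm
  · rw [hφx, measureReal_tsum_le_eq_dyadicCDF P X hX hind hunif]
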